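/- Let $n\ge 0$ and $k\ge 1$ be integers, write $(\underline z,w)=(z_1,\dots,z_n,w)$ for the coordinates of $\mathbb C^{n+1}$, and let $f(\underline z,w)$ be a germ of holomorphic function at $(\underline 0,0)\in\mathbb C^{n+1}$ such that $w\mapsto f(\underline 0,w)$ vanishes to order exactly $k$ at $w=0$. Then, up to an analytic change of coordinates, $f$ becomes a monic polynomial of degree $k$ in $w$, and the change of coordinates can be chosen to modify the $w$-coordinate only. Precisely: there are a germ of biholomorphism $\Phi:(\mathbb C^{n+1},0)\to(\mathbb C^{n+1},0)$ of the form $\Phi(\underline z,w)=(\underline z,\phi(\underline z,w))$ and germs of holomorphic functions $f_0,\dots,f_{k-1}$ at $\underline 0\in\mathbb C^n$ with $f_i(\underline 0)=0$ for all $i$, such that, near the origin, $$f\circ\Phi^{-1}(\underline z,w)=w^k+f_{k-1}(\underline z)\,w^{k-1}+\cdots+f_1(\underline z)\,w+f_0(\underline z).$$ -/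

import Mathlib

open Filter Topology

/-- An analytic change of coordinates of a complex normed space `E` at the origin: a homeomorphism
between two open neighbourhoods of `0`, fixing `0`, holomorphic with holomorphic inverse. -/
structure IsAnalyticCoordinateChange {E : Type*} [NormedAddCommGroup E] [NormedSpace ℂ E]
    (Φ : OpenPartialHomeomorph E E) : Prop where
  zero_mem_source : (0 : E) ∈ Φ.source
  map_zero : Φ 0 = 0
  analytic_toFun : AnalyticOnNhd ℂ Φ Φ.source
  analytic_symm : AnalyticOnNhd ℂ Φ.symm Φ.target

/-- An analytic change of the `w`-coordinate alone: an analytic change of coordinates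
of `ℂⁿ × ℂ` at the origin of the form `(z, w) ↦ (z, φ(z, w))`. -/
structure IsAnalyticChangeOfLastCoordinate {n : ℕ}
    (Φ : OpenPartialHomeomorph ((Fin n → ℂ) × ℂ) ((Fin n → ℂ) × ℂ)) : Prop
    extends IsAnalyticCoordinateChange Φ where
  fst_eq : ∀ p ∈ Φ.source, (Φ p).1 = p.1

/-!
Write `k = m + 1` and `f (0, w) = (w ρ(w)) ^ k` with `ρ 0 ≠ 0`. The theorem asks for analytic germs
`c i (z)` and `φ (z, w)` with `f (z, w) = φ ^ k + ∑ i, c i (z) φ ^ i` and `∂φ/∂w ≠ 0` at the origin;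
then `(z, w) ↦ (z, φ (z, w))` is the change of coordinates.

For fixed `z` this is an equation in the disc algebra, for the unknowns `c ∈ ℂᵐ` and `φ` in the
disc algebra, the right-hand side being the function `f (z, t ·)` for a fixed small scale `t`. The
map `unfolding : (c, φ) ↦ φ ^ k + ∑ i < m, c i φ ^ i` is polynomial in a Banach algebra, so no
derivatives are lost. Its differential at `(0, s)`, where `s ^ k = f (0, t ·)`, is
`(δc, δφ) ↦ ∑ i < m, δc i s ^ i + k s ^ m δφ`. Since `s` is the coordinate function times a unit,
this is bijective: it expresses division with remainder by `s ^ m`. The analytic inverse function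
theorem therefore solves the equation near `s ^ k`, with a solution depending analytically on the
right-hand side (`discAlgebra.exists_analyticAt_unfolding_eq`).

It remains to pass between germs of functions of `(z, w)` and analytic families in the disc algebra.
The map `z ↦ f (z, t ·)` is analytic because the power series of `f` can be evaluated in the disc
algebra (`discAlgebra.exists_analyticAt_eval_eq`). Conversely, evaluation `(a, x) ↦ a x` is jointly
analytic near `x = 0`, by a resolvent formula (`discAlgebra.exists_analyticAt_eq_eval`).
-/

/-! ### The disc algebra -/

/-- The disc algebra: continuous functions on the closed unit disc that are holomorphic in its
interior. Holomorphy is expressed through some function on `ℂ` agreeing with `u` on the disc. -/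
def discAlgebra : Subalgebra ℂ C(Metric.closedBall (0 : ℂ) 1, ℂ) where
  carrier := {u | ∃ g : ℂ → ℂ, DifferentiableOn ℂ g (Metric.ball 0 1) ∧ ∀ x, u x = g x}
  mul_mem' := by
    rintro u v ⟨g, hg, hug⟩ ⟨h, hh, hvh⟩
    exact ⟨fun w => g w * h w, hg.mul hh, fun x => by simp [hug, hvh]⟩
  add_mem' := by
    rintro u v ⟨g, hg, hug⟩ ⟨h, hh, hvh⟩
    exact ⟨fun w => g w + h w, hg.add hh, fun x => by simp [hug, hvh]⟩
  algebraMap_mem' c := ⟨fun _ => c, differentiableOn_const c, fun x => rfl⟩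

namespace discAlgebra

lemma isClosed : IsClosed (discAlgebra : Set C(Metric.closedBall (0 : ℂ) 1, ℂ)) := by
  refine isClosed_of_closure_subset fun u hu => ?_
  obtain ⟨v, hv, hlim⟩ := mem_closure_iff_seq_limit.1 hu
  choose g hg hvg using hv
  have hball : ∀ w ∈ Metric.ball (0 : ℂ) 1, w ∈ Metric.closedBall (0 : ℂ) 1 :=
    fun w hw => Metric.ball_subset_closedBall hw
  let e : ℂ → ℂ := Function.extend Subtype.val u 0
  have he : ∀ x : Metric.closedBall (0 : ℂ) 1, e x = u x :=
    fun x => Subtype.val_injective.extend_apply _ _ x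
  refine ⟨e, ?_, fun x => (he x).symm⟩
  have hunif : TendstoUniformlyOn g e atTop (Metric.ball 0 1) := by
    rw [Metric.tendstoUniformlyOn_iff]
    intro ε hε
    filter_upwards [(Metric.tendstoUniformly_iff.1
      (ContinuousMap.tendsto_iff_tendstoUniformly.1 hlim)) ε hε] with n hn w hw
    have := hn ⟨w, hball w hw⟩
    rwa [hvg, ← he] at this
  exact hunif.tendstoLocallyUniformlyOn.differentiableOn (Eventually.of_forall hg) Metric.isOpen_ball

instance : CompleteSpace discAlgebra := isClosed.completeSpace_coe

/-- Evaluation at a point of the closed disc, as a continuous linear form. -/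
noncomputable def eval (x : Metric.closedBall (0 : ℂ) 1) : discAlgebra →L[ℂ] ℂ :=
  (ContinuousMap.evalCLM ℂ x).comp discAlgebra.toSubmodule.subtypeL

@[simp]
lemma eval_apply (x : Metric.closedBall (0 : ℂ) 1) (a : discAlgebra) : eval x a = a.1 x := rfl

lemma eval_mul (x : Metric.closedBall (0 : ℂ) 1) (a b : discAlgebra) :
    eval x (a * b) = eval x a * eval x b := rfl

lemma eval_pow (x : Metric.closedBall (0 : ℂ) 1) (a : discAlgebra) (m : ℕ) :
    eval x (a ^ m) = eval x a ^ m := rfl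

lemma ext_eval {a b : discAlgebra} (h : ∀ x, eval x a = eval x b) : a = b :=
  Subtype.ext (ContinuousMap.ext h)

lemma norm_le {a : discAlgebra} {C : ℝ} (hC : 0 ≤ C) (h : ∀ x, ‖eval x a‖ ≤ C) : ‖a‖ ≤ C :=
  (ContinuousMap.norm_le _ hC).2 h

lemma exists_eval_eq {g : ℂ → ℂ} (hc : ContinuousOn g (Metric.closedBall 0 1))
    (hd : DifferentiableOn ℂ g (Metric.ball 0 1)) : ∃ a : discAlgebra, ∀ x, eval x a = g x :=
  ⟨⟨⟨_, hc.domRestrict⟩, g, hd, fun _ => rfl⟩, fun _ => rfl⟩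

lemma exists_eval_eq_of_differentiable {g : ℂ → ℂ} (hd : Differentiable ℂ g) :
    ∃ a : discAlgebra, ∀ x, eval x a = g x :=
  exists_eval_eq hd.continuous.continuousOn hd.differentiableOn

lemma exists_extension (a : discAlgebra) : ∃ g : ℂ → ℂ, ContinuousOn g (Metric.closedBall 0 1) ∧
    DifferentiableOn ℂ g (Metric.ball 0 1) ∧ ∀ x, eval x a = g x := by
  obtain ⟨g, hg, h⟩ := a.2
  refine ⟨g, continuousOn_iff_continuous_domRestrict.2 ?_, hg, h⟩
  exact a.1.continuous.congr h

/-! ### Analytic families of functions on the disc -/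

variable {Z : Type*} [NormedAddCommGroup Z] [NormedSpace ℂ Z]

/-- The linear map `(z, t) ↦ (z, x t)`. -/
noncomputable def scaleSnd (x : ℂ) : Z × ℂ →L[ℂ] Z × ℂ :=
  (ContinuousLinearMap.id ℂ Z).prodMap (x • ContinuousLinearMap.id ℂ ℂ)

@[simp]
lemma scaleSnd_apply (x : ℂ) (p : Z × ℂ) : scaleSnd x p = (p.1, x * p.2) := rfl

lemma norm_scaleSnd_le {x : ℂ} (hx : ‖x‖ ≤ 1) (p : Z × ℂ) : ‖scaleSnd x p‖ ≤ ‖p‖ := by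
  simp only [scaleSnd_apply, Prod.norm_mk, Prod.norm_def p, norm_mul]
  gcongr
  exact mul_le_of_le_one_left (norm_nonneg _) hx

/-- A multilinear form `q` on `Z × ℂ` extends to the functions `x ↦ (z, x t)` with values in the
disc algebra. -/
lemma exists_multilinear_eval {m : ℕ} (q : ContinuousMultilinearMap ℂ (fun _ : Fin m => Z × ℂ) ℂ) :
    ∃ Q : ContinuousMultilinearMap ℂ (fun _ : Fin m => Z × ℂ) discAlgebra, ‖Q‖ ≤ ‖q‖ ∧
      ∀ v x, eval x (Q v) = q fun i => scaleSnd (x : ℂ) (v i) := by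
  have hex : ∀ v : Fin m → Z × ℂ, ∃ a : discAlgebra,
      ∀ x, eval x a = q fun i => scaleSnd (x : ℂ) (v i) := fun v => by
    refine exists_eval_eq_of_differentiable (g := fun w => q fun i => scaleSnd w (v i)) ?_
    have h1 : Differentiable ℂ fun y => q y := q.contDiff.differentiable (n := 1) (by simp)
    refine h1.comp (g := fun y => q y) (f := fun w i => scaleSnd w (v i)) ?_
    simp only [scaleSnd_apply]
    fun_prop
  choose Q hQ using hex
  let qs (x : ℂ) := q.compContinuousLinearMap fun _ => scaleSnd (Z := Z) x
  have hQ' : ∀ v x, eval x (Q v) = qs x v := hQ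
  let Q' : MultilinearMap ℂ (fun _ : Fin m => Z × ℂ) discAlgebra :=
    { toFun := Q
      map_update_add' := fun v i a b => ext_eval fun x => by
        rw [map_add, hQ', hQ', hQ', (qs x).map_update_add]
      map_update_smul' := fun v i c a => ext_eval fun x => by
        rw [map_smul, hQ', hQ', (qs x).map_update_smul] }
  have hb : ∀ v, ‖Q' v‖ ≤ ‖q‖ * ∏ i, ‖v i‖ := fun v => by
    refine norm_le (by positivity) fun x => ?_
    change ‖eval x (Q v)‖ ≤ _
    rw [hQ]
    refine (q.le_opNorm _).trans ?_
    gcongr with i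
    exact norm_scaleSnd_le (mem_closedBall_zero_iff.1 x.2) _
  exact ⟨Q'.mkContinuous ‖q‖ hb, Q'.mkContinuous_norm_le (norm_nonneg _) hb, hQ⟩

/-- If `f` is analytic at the origin of `Z × ℂ`, the functions `x ↦ f (z, x t)` on the closed unit
disc depend analytically on `(z, t)` near the origin, as elements of the disc algebra: the
homogeneous terms of the power series of `f` can be evaluated in the disc algebra with no loss in
norm. -/
lemma exists_analyticAt_eval_eq {f : Z × ℂ → ℂ} (hf : AnalyticAt ℂ f 0) :
    ∃ F : Z × ℂ → discAlgebra, AnalyticAt ℂ F 0 ∧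
      ∀ᶠ p in 𝓝 (0 : Z × ℂ), ∀ x, eval x (F p) = f (p.1, x * p.2) := by
  obtain ⟨p, r, hp⟩ := hf
  choose Q hQn hQ using fun m => exists_multilinear_eval (p m)
  let P : FormalMultilinearSeries ℂ (Z × ℂ) discAlgebra := Q
  have hrad : p.radius ≤ P.radius := by
    refine ENNReal.le_of_forall_nnreal_lt fun s hs => ?_
    obtain ⟨C, hC, h⟩ := p.norm_mul_pow_le_of_lt_radius hs
    exact P.le_radius_of_bound C fun m => (by gcongr; exact hQn m : _ ≤ _).trans (h m)
  have hpos : 0 < P.radius := hp.r_pos.trans_le (hp.r_le.trans hrad)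
  refine ⟨P.sum, (P.hasFPowerSeriesOnBall hpos).analyticAt, ?_⟩
  filter_upwards [Metric.eball_mem_nhds 0 hp.r_pos] with y hy x
  have h1 : HasSum (fun m => P m fun _ => y) (P.sum y) := by
    simpa using (P.hasFPowerSeriesOnBall hpos).hasSum
      (Metric.eball_subset_eball (hp.r_le.trans hrad) hy)
  have h2 := h1.mapL (eval x)
  have hy' : scaleSnd (x : ℂ) y ∈ Metric.eball (0 : Z × ℂ) r := by
    rw [Metric.mem_eball, edist_zero_right] at hy ⊢
    refine lt_of_le_of_lt ?_ hy
    exact enorm_le_iff_norm_le.2 (norm_scaleSnd_le (mem_closedBall_zero_iff.1 x.2) y)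
  have h3 := hp.hasSum hy'
  rw [zero_add] at h3
  exact h2.unique ((funext fun m => hQ m _ x : _ = _) ▸ h3)

/-! ### Division in the disc algebra -/

/-- The centre of the disc. -/
def origin : Metric.closedBall (0 : ℂ) 1 := ⟨0, by simp⟩

/-- The coordinate function `x ↦ x`. -/
noncomputable def X : discAlgebra :=
  ⟨⟨Subtype.val, continuous_subtype_val⟩, id, differentiableOn_id, fun _ => rfl⟩

@[simp]
lemma eval_X (x : Metric.closedBall (0 : ℂ) 1) : eval x X = x := rfl

lemma exists_eq_add_X_mul (a : discAlgebra) :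
    ∃ b, a = algebraMap ℂ discAlgebra (eval origin a) + X * b := by
  obtain ⟨g, hc, hd, h⟩ := exists_extension a
  have h0 : DifferentiableAt ℂ g 0 := hd.differentiableAt (Metric.ball_mem_nhds 0 one_pos)
  obtain ⟨b, hb⟩ := exists_eval_eq (g := dslope g 0)
    ((continuousOn_dslope (Metric.closedBall_mem_nhds 0 one_pos)).2 ⟨hc, h0⟩)
    ((Complex.differentiableOn_dslope (Metric.ball_mem_nhds 0 one_pos)).2 hd)
  refine ⟨b, ext_eval fun x => ?_⟩
  have := sub_smul_dslope g 0 (x : ℂ)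
  have hC : eval x (algebraMap ℂ discAlgebra (eval origin a)) = eval origin a := rfl
  have h00 : eval origin a = g 0 := h origin
  rw [map_add, eval_mul, hC, eval_X, hb, h00, h x]
  simp only [sub_zero, smul_eq_mul] at this
  rw [this]
  ring

lemma eq_zero_of_X_mul_eq_zero {b : discAlgebra} (hb : X * b = 0) : b = 0 := by
  have hne : ∀ x : Metric.closedBall (0 : ℂ) 1, (x : ℂ) ≠ 0 → eval x b = 0 := fun x hx => by
    have := congrArg (eval x) hb
    rw [eval_mul, eval_X, map_zero] at this
    exact (mul_eq_zero.1 this).resolve_left hx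
  obtain ⟨g, hc, -, h⟩ := exists_extension b
  have hg : ContinuousAt g 0 := hc.continuousAt (Metric.closedBall_mem_nhds 0 one_pos)
  -- the value at the centre is recovered by continuity
  have h0 : g 0 = 0 := by
    refine tendsto_nhds_unique (f := g) (l := 𝓝[≠] (0 : ℂ)) (hg.mono_left nhdsWithin_le_nhds)
      (tendsto_const_nhds.congr' ?_)
    filter_upwards [self_mem_nhdsWithin,
      mem_nhdsWithin_of_mem_nhds (Metric.closedBall_mem_nhds (0 : ℂ) one_pos)] with x hx hx1
    rw [← h ⟨x, hx1⟩, hne ⟨x, hx1⟩ hx]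
  refine ext_eval fun x => ?_
  rw [map_zero]
  by_cases hx : (x : ℂ) = 0
  · rw [h, hx, h0]
  · exact hne x hx

section Division

variable {v : discAlgebra} (hv : IsUnit v)
include hv

lemma exists_eq_add_mul_of_isUnit (a : discAlgebra) :
    ∃ b, a = algebraMap ℂ discAlgebra (eval origin a) + X * v * b := by
  obtain ⟨b, hb⟩ := exists_eq_add_X_mul a
  obtain ⟨u, rfl⟩ := hv
  refine ⟨(u⁻¹ : discAlgebraˣ) * b, ?_⟩
  rw [mul_assoc, u.mul_inv_cancel_left]
  exact hb

/-- Division with remainder by `(X * v) ^ m`, the remainder being a polynomial in `X * v`. -/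
lemma exists_eq_sum_add_pow_mul (m : ℕ) (a : discAlgebra) :
    ∃ (c : Fin m → ℂ) (b : discAlgebra),
      a = ∑ i, c i • (X * v) ^ (i : ℕ) + (X * v) ^ m * b := by
  induction m with
  | zero => exact ⟨0, a, by simp⟩
  | succ m ih =>
    obtain ⟨c, b, hb⟩ := ih
    obtain ⟨b', hb'⟩ := exists_eq_add_mul_of_isUnit hv b
    refine ⟨Fin.snoc c (eval origin b), b', ?_⟩
    simp only [Fin.sum_univ_castSucc, Fin.snoc_castSucc, Fin.snoc_last, Fin.val_castSucc,
      Fin.val_last]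
    rw [hb, Algebra.smul_def (eval origin b)]
    nth_rw 1 [hb']
    ring

lemma eq_zero_of_sum_add_pow_mul_eq_zero {m : ℕ} {c : Fin m → ℂ} {b : discAlgebra}
    (h : ∑ i, c i • (X * v) ^ (i : ℕ) + (X * v) ^ m * b = 0) : c = 0 ∧ b = 0 := by
  induction m with
  | zero => exact ⟨Subsingleton.elim _ _, by simpa using h⟩
  | succ m ih =>
    have hfac : c 0 • (1 : discAlgebra) + X * (v * (∑ i : Fin m, c i.succ • (X * v) ^ (i : ℕ) +
        (X * v) ^ m * b)) = 0 := by
      rw [← h, Fin.sum_univ_succ, mul_add, Finset.mul_sum, mul_add, Finset.mul_sum]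
      simp only [Fin.val_zero, pow_zero, Fin.val_succ, pow_succ, mul_smul_comm]
      rw [← add_assoc]
      congr 1
      · congr 1
        exact Finset.sum_congr rfl fun i _ => by congr 1; ring
      · ring
    have hc0 : c 0 = 0 := by
      have := congrArg (eval origin) hfac
      have h1 : eval origin 1 = 1 := rfl
      have h0 : ((origin : Metric.closedBall (0 : ℂ) 1) : ℂ) = 0 := rfl
      simpa only [map_add, map_smul, eval_mul, eval_X, h1, h0, zero_mul, add_zero, smul_eq_mul,
        mul_one, map_zero] using this
    rw [hc0, zero_smul, zero_add] at hfac
    obtain ⟨h1, h2⟩ := ih (c := fun i => c i.succ)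
      (hv.mul_right_eq_zero.1 (eq_zero_of_X_mul_eq_zero hfac))
    exact ⟨funext (Fin.cases hc0 fun i => congrFun h1 i), h2⟩

end Division

/-! ### Joint analyticity of the evaluation -/

lemma analyticAt_inverse_one_sub_smul_apply {B : Type*} [NormedAddCommGroup B] [NormedSpace ℂ B]
    [CompleteSpace B] (D : B →L[ℂ] B) (a : B) :
    AnalyticAt ℂ (fun p : B × ℂ => Ring.inverse (1 - p.2 • D) p.1) (a, 0) := by
  have h1 : AnalyticAt ℂ (Ring.inverse : (B →L[ℂ] B) → B →L[ℂ] B)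
      (1 - ((a, 0) : B × ℂ).2 • D) := by
    simpa using analyticAt_inverse (𝕜 := ℂ) (1 : (B →L[ℂ] B)ˣ)
  have h2 : AnalyticAt ℂ (fun p : B × ℂ => 1 - p.2 • D) (a, 0) :=
    analyticAt_const.sub (analyticAt_snd.smul analyticAt_const)
  have h3 : AnalyticAt ℂ (fun p : B × ℂ => Ring.inverse (1 - p.2 • D)) (a, 0) :=
    AnalyticAt.comp (g := Ring.inverse) (f := fun p : B × ℂ => 1 - p.2 • D) h1 h2
  exact AnalyticAt.comp (g := fun q : (B →L[ℂ] B) × B => q.1 q.2)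
    (f := fun p : B × ℂ => (Ring.inverse (1 - p.2 • D), p.1))
    ((ContinuousLinearMap.id ℂ (B →L[ℂ] B)).analyticAt_bilinear _) (h3.prod analyticAt_fst)

lemma eventually_inverse_one_sub_smul_apply {B : Type*} [NormedAddCommGroup B] [NormedSpace ℂ B]
    [CompleteSpace B] (D : B →L[ℂ] B) : ∀ᶠ x in 𝓝 (0 : ℂ), ∀ a,
      Ring.inverse (1 - x • D : B →L[ℂ] B) a -
        x • D (Ring.inverse (1 - x • D : B →L[ℂ] B) a) = a := by
  have hlim : Tendsto (fun x : ℂ => ‖x • D‖) (𝓝 0) (𝓝 0) := by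
    have hc : Continuous fun x : ℂ => ‖x • D‖ := (continuous_id.smul continuous_const).norm
    simpa using hc.tendsto 0
  filter_upwards [hlim.eventually_lt_const one_pos] with x hx a
  have hu : IsUnit (1 - x • D) := isUnit_one_sub_of_norm_lt_one hx
  have := congrArg (fun T : B →L[ℂ] B => T a) (Ring.mul_inverse_cancel _ hu)
  simpa using this

lemma exists_divX : ∃ D : discAlgebra →L[ℂ] discAlgebra,
    ∀ a, a = algebraMap ℂ discAlgebra (eval origin a) + X * D a := by
  let T : discAlgebra →L[ℂ] discAlgebra := ContinuousLinearMap.mul ℂ discAlgebra X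
  let M : ℂ × discAlgebra →L[ℂ] discAlgebra :=
    (Algebra.linearMap ℂ discAlgebra).toContinuousLinearMap.coprod T
  have hM : ∀ p, M p = algebraMap ℂ discAlgebra p.1 + X * p.2 := fun p => rfl
  have h1 : eval origin 1 = 1 := rfl
  have h0 : ((origin : Metric.closedBall (0 : ℂ) 1) : ℂ) = 0 := rfl
  have hev : ∀ p, eval origin (M p) = p.1 := fun p => by
    rw [hM, map_add, eval_mul, eval_X, h0, zero_mul, add_zero, Algebra.algebraMap_eq_smul_one,
      map_smul, h1, smul_eq_mul, mul_one]
  have hinj : M.ker = ⊥ := by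
    refine LinearMap.ker_eq_bot'.2 fun p hp => ?_
    have hp' : M p = 0 := hp
    have hp1 : p.1 = 0 := by rw [← hev p, hp', map_zero]
    rw [hM, hp1, map_zero, zero_add] at hp'
    exact Prod.ext hp1 (eq_zero_of_X_mul_eq_zero hp')
  have hsurj : M.range = ⊤ := by
    refine LinearMap.range_eq_top.2 fun a => ?_
    obtain ⟨b, hb⟩ := exists_eq_add_X_mul a
    exact ⟨(eval origin a, b), hb.symm⟩
  let e := ContinuousLinearEquiv.ofBijective M hinj hsurj
  refine ⟨(ContinuousLinearMap.snd ℂ ℂ discAlgebra).comp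
    (e.symm : discAlgebra →L[ℂ] ℂ × discAlgebra),
    fun a => ?_⟩
  have ha : M (e.symm a) = a := e.apply_symm_apply a
  have h := hev (e.symm a)
  rw [ha] at h
  conv_lhs => rw [← ha, hM, ← h]
  rfl

/-- Near the centre of the disc the evaluation `(a, x) ↦ a x` is jointly analytic. Writing `D` for
the operator `a ↦ (a - a 0) / x`, one has `a x = ((1 - x D)⁻¹ a) 0`, and inversion is analytic in
the Banach algebra of operators. -/
lemma exists_analyticAt_eq_eval : ∃ E : discAlgebra × ℂ → ℂ, (∀ a, AnalyticAt ℂ E (a, 0)) ∧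
    ∀ᶠ x in 𝓝 (0 : ℂ), ∀ (hx : x ∈ Metric.closedBall (0 : ℂ) 1) (a : discAlgebra),
      eval ⟨x, hx⟩ a = E (a, x) := by
  obtain ⟨D, hD⟩ := exists_divX
  refine ⟨fun p => eval origin (Ring.inverse (1 - p.2 • D) p.1), fun a => ?_, ?_⟩
  · exact ((eval origin).analyticAt _).comp (analyticAt_inverse_one_sub_smul_apply D a)
  · filter_upwards [eventually_inverse_one_sub_smul_apply D] with x hxD hx a
    have hba := hxD a
    set b := Ring.inverse (1 - x • D) a
    have hxb := congrArg (eval ⟨x, hx⟩) (hD b)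
    have hC : eval ⟨x, hx⟩ (algebraMap ℂ discAlgebra (eval origin b)) = eval origin b := rfl
    rw [map_add, eval_mul, hC, eval_X] at hxb
    rw [← hba, map_sub, map_smul, smul_eq_mul, hxb, add_sub_cancel_right]

/-! ### Polynomials with parameters on the disc algebra -/

/-- The map `(c, y) ↦ y ^ (m + 1) + ∑ i < m, c i • y ^ i` on `ℂᵐ × discAlgebra`. There is no term of
degree `m`; this makes its differential at suitable points bijective. -/
noncomputable def unfolding (m : ℕ) (p : (Fin m → ℂ) × discAlgebra) : discAlgebra :=
  p.2 ^ (m + 1) + ∑ i, p.1 i • p.2 ^ (i : ℕ)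

lemma eval_unfolding {m : ℕ} (x : Metric.closedBall (0 : ℂ) 1) (p : (Fin m → ℂ) × discAlgebra) :
    eval x (unfolding m p) = eval x p.2 ^ (m + 1) + ∑ i, p.1 i * eval x p.2 ^ (i : ℕ) := by
  simp only [unfolding, map_add, map_sum, map_smul, eval_pow, smul_eq_mul]

lemma analyticAt_unfolding {m : ℕ} (p : (Fin m → ℂ) × discAlgebra) :
    AnalyticAt ℂ (unfolding m) p := by
  have hi : ∀ i : Fin m, AnalyticAt ℂ (fun q : (Fin m → ℂ) × discAlgebra => q.1 i) p := fun i =>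
    ((ContinuousLinearMap.proj (R := ℂ) (φ := fun _ : Fin m => ℂ) i).comp
      (ContinuousLinearMap.fst ℂ (Fin m → ℂ) discAlgebra)).analyticAt p
  exact (analyticAt_snd.pow (m + 1)).add
    (Finset.analyticAt_fun_sum _ fun i _ => (hi i).smul (analyticAt_snd.pow i))

/-- The differential `(δc, δy) ↦ (m + 1) s ^ m δy + ∑ i < m, δc i • s ^ i` of `unfolding` at
`(0, s)`. -/
noncomputable def unfoldingDeriv (m : ℕ) (s : discAlgebra) :
    (Fin m → ℂ) × discAlgebra →L[ℂ] discAlgebra :=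
  (((m + 1 : ℕ) : ℂ) • ContinuousLinearMap.mul ℂ discAlgebra (s ^ m)).comp
      (ContinuousLinearMap.snd ℂ (Fin m → ℂ) discAlgebra) +
    ∑ i : Fin m, ((ContinuousLinearMap.proj (R := ℂ) (φ := fun _ : Fin m => ℂ) i).comp
      (ContinuousLinearMap.fst ℂ (Fin m → ℂ) discAlgebra)).smulRight (s ^ (i : ℕ))

lemma unfoldingDeriv_apply (m : ℕ) (s : discAlgebra) (p : (Fin m → ℂ) × discAlgebra) :
    unfoldingDeriv m s p =
      ∑ i, p.1 i • s ^ (i : ℕ) + s ^ m * (((m + 1 : ℕ) : ℂ) • p.2) := by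
  simp only [unfoldingDeriv, add_apply, sum_apply]
  rw [add_comm, mul_smul_comm]
  rfl

lemma hasFDerivAt_unfolding (m : ℕ) (s : discAlgebra) :
    HasFDerivAt (unfolding m) (unfoldingDeriv m s) (0, s) := by
  refine HasFDerivAt.add ?_ (HasFDerivAt.fun_sum fun i _ => ?_)
  · refine ((hasFDerivAt_snd (𝕜 := ℂ) (p := ((0, s) : (Fin m → ℂ) × discAlgebra))).pow
      (m + 1)).congr_fderiv ?_
    ext p <;> simp [mul_assoc]
  · let π := (ContinuousLinearMap.proj (R := ℂ) (φ := fun _ : Fin m => ℂ) i).comp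
      (ContinuousLinearMap.fst ℂ (Fin m → ℂ) discAlgebra)
    have h1 : HasFDerivAt (fun p : (Fin m → ℂ) × discAlgebra => p.1 i) π (0, s) := π.hasFDerivAt
    have h2 := ((hasFDerivAt_snd (𝕜 := ℂ) (p := ((0, s) : (Fin m → ℂ) × discAlgebra))).pow (i : ℕ))
    refine (h1.smul h2).congr_fderiv ?_
    ext p <;> simp [π]

/-- Bijectivity of the differential is division with remainder by `(X * v) ^ m`; the open mapping
theorem makes the inverse continuous. -/
lemma exists_equiv_unfoldingDeriv (m : ℕ) {v : discAlgebra} (hv : IsUnit v) :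
    ∃ e : ((Fin m → ℂ) × discAlgebra) ≃L[ℂ] discAlgebra,
      (e : (Fin m → ℂ) × discAlgebra →L[ℂ] discAlgebra) = unfoldingDeriv m (X * v) := by
  have hm : ((m + 1 : ℕ) : ℂ) ≠ 0 := Nat.cast_ne_zero.2 m.succ_ne_zero
  have hinj : (unfoldingDeriv m (X * v)).ker = ⊥ := by
    refine LinearMap.ker_eq_bot'.2 fun p hp => ?_
    have hp' : unfoldingDeriv m (X * v) p = 0 := hp
    rw [unfoldingDeriv_apply] at hp'
    obtain ⟨h1, h2⟩ := eq_zero_of_sum_add_pow_mul_eq_zero hv hp'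
    exact Prod.ext h1 ((smul_eq_zero.1 h2).resolve_left hm)
  have hsurj : (unfoldingDeriv m (X * v)).range = ⊤ := by
    refine LinearMap.range_eq_top.2 fun a => ?_
    obtain ⟨c, b, h⟩ := exists_eq_sum_add_pow_mul hv m a
    refine ⟨(c, (((m + 1 : ℕ) : ℂ))⁻¹ • b), ?_⟩
    refine (unfoldingDeriv_apply m (X * v) _).trans ?_
    rw [smul_inv_smul₀ hm, ← h]
  exact ⟨ContinuousLinearEquiv.ofBijective _ hinj hsurj,
    ContinuousLinearEquiv.coe_ofBijective _ hinj hsurj⟩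

end discAlgebra

/-- The inverse function theorem for analytic maps between Banach spaces. -/
lemma AnalyticAt.exists_openPartialHomeomorph {E F : Type*} [NormedAddCommGroup E]
    [NormedSpace ℂ E] [CompleteSpace E] [NormedAddCommGroup F] [NormedSpace ℂ F] [CompleteSpace F]
    {f : E → F} {a : E} (hf : AnalyticAt ℂ f a) (e : E ≃L[ℂ] F)
    (he : HasFDerivAt f (e : E →L[ℂ] F) a) :
    ∃ Φ : OpenPartialHomeomorph E F, (Φ : E → F) = f ∧ a ∈ Φ.source ∧
      AnalyticAt ℂ Φ.symm (f a) := by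
  have hs : HasStrictFDerivAt f (e : E →L[ℂ] F) a := he.fderiv ▸ hf.hasStrictFDerivAt
  refine ⟨hs.toOpenPartialHomeomorph f, rfl, hs.mem_toOpenPartialHomeomorph_source, ?_⟩
  exact (hs.toOpenPartialHomeomorph f).analyticAt_symm' hs.mem_toOpenPartialHomeomorph_source hf
    he.fderiv

namespace discAlgebra

/-- The inverse function theorem for `unfolding`: near `s ^ (m + 1)`, where `s` has a simple zero at
the centre and no other zero, elements of the disc algebra are values of polynomials of degree
`m + 1`, in an analytic way. -/
lemma exists_analyticAt_unfolding_eq (m : ℕ) {v : discAlgebra} (hv : IsUnit v) :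
    ∃ G : discAlgebra → (Fin m → ℂ) × discAlgebra, AnalyticAt ℂ G ((X * v) ^ (m + 1)) ∧
      G ((X * v) ^ (m + 1)) = (0, X * v) ∧
      ∀ᶠ a in 𝓝 ((X * v) ^ (m + 1)), unfolding m (G a) = a := by
  obtain ⟨e, he⟩ := exists_equiv_unfoldingDeriv m hv
  obtain ⟨Φ, hΦ, hmem, hsymm⟩ := (analyticAt_unfolding (0, X * v)).exists_openPartialHomeomorph e
    (he ▸ hasFDerivAt_unfolding m (X * v))
  have hval : unfolding m (0, X * v) = (X * v) ^ (m + 1) := by simp [unfolding]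
  rw [hval] at hsymm
  refine ⟨Φ.symm, hsymm, ?_, ?_⟩
  · rw [← hval, ← hΦ, Φ.left_inv hmem]
  · have h := Φ.map_source hmem
    rw [hΦ, hval] at h
    filter_upwards [Φ.open_target.mem_nhds h] with a ha
    rw [← hΦ, Φ.right_inv ha]

end discAlgebra

/-! ### Change of the last coordinate -/

section Reduction

variable {Z : Type*} [NormedAddCommGroup Z] [NormedSpace ℂ Z]

open discAlgebra in
/-- If `f (0, w) = (w ρ(w)) ^ (m + 1)` with `ρ 0 ≠ 0`, then `f` is a polynomial in a function `φ`
extending `w ρ(w)`, with coefficients depending on `z` only. -/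
lemma exists_analyticAt_eq_pow_add_sum {f : Z × ℂ → ℂ} (hf : AnalyticAt ℂ f 0) {m : ℕ} {ρ : ℂ → ℂ}
    (hρ : AnalyticAt ℂ ρ 0) (hρ0 : ρ 0 ≠ 0)
    (hfρ : ∀ᶠ w in 𝓝 (0 : ℂ), f (0, w) = (w * ρ w) ^ (m + 1)) :
    ∃ (φ : Z × ℂ → ℂ) (c : Fin m → Z → ℂ), AnalyticAt ℂ φ 0 ∧
      (∀ᶠ w in 𝓝 (0 : ℂ), φ (0, w) = w * ρ w) ∧ (∀ i, AnalyticAt ℂ (c i) 0 ∧ c i 0 = 0) ∧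
      ∀ᶠ p in 𝓝 (0 : Z × ℂ), f p = φ p ^ (m + 1) + ∑ i, c i p.1 * φ p ^ (i : ℕ) := by
  obtain ⟨F, hF, hFf⟩ := exists_analyticAt_eval_eq hf
  obtain ⟨E, hE, hEe⟩ := exists_analyticAt_eq_eval
  -- a scale `t` at which everything converges on the disc of radius `t`
  obtain ⟨δ, hδ, hgood⟩ := Metric.eventually_nhds_iff.1
    ((hρ.eventually_analyticAt.and (hρ.continuousAt.eventually_ne hρ0)).and hfρ)
  have hcont : Tendsto (fun t : ℂ => ((0, t) : Z × ℂ)) (𝓝 0) (𝓝 0) :=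
    (Continuous.prodMk_right (0 : Z)).tendsto 0
  obtain ⟨t, ⟨ht0, htδ⟩, hFt, hFft⟩ : ∃ t : ℂ, (t ≠ 0 ∧ ‖t‖ < δ) ∧ AnalyticAt ℂ F (0, t) ∧
      ∀ᶠ p in 𝓝 ((0, t) : Z × ℂ), ∀ x, eval x (F p) = f (p.1, x * p.2) := by
    have h1 : ∀ᶠ t in 𝓝 (0 : ℂ), ‖t‖ < δ := by
      filter_upwards [Metric.ball_mem_nhds (0 : ℂ) hδ] with t ht using mem_ball_zero_iff.1 ht
    have h2 := hcont.eventually (hF.eventually_analyticAt.and hFf.eventually_nhds)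
    have h3 : ∀ᶠ t in 𝓝[≠] (0 : ℂ), t ≠ 0 := self_mem_nhdsWithin
    obtain ⟨t, h⟩ := (h3.and ((h1.and h2).filter_mono nhdsWithin_le_nhds)).exists
    exact ⟨t, ⟨h.1, h.2.1⟩, h.2.2⟩
  have hscale : ∀ x ∈ Metric.closedBall (0 : ℂ) 1, dist (t * x) 0 < δ := fun x hx => by
    rw [dist_zero_right, norm_mul]
    exact (mul_le_of_le_one_right (norm_nonneg _) (mem_closedBall_zero_iff.1 hx)).trans_lt htδ
  have hρd : ∀ x ∈ Metric.closedBall (0 : ℂ) 1, DifferentiableAt ℂ (fun x => t * ρ (t * x)) x :=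
    fun x hx => by
      have h1 : DifferentiableAt ℂ ρ (t * x) := (hgood (hscale x hx)).1.1.differentiableAt
      exact (h1.comp x (differentiableAt_id.const_mul t)).const_mul t
  have hρne : ∀ x ∈ Metric.closedBall (0 : ℂ) 1, t * ρ (t * x) ≠ 0 :=
    fun x hx => mul_ne_zero ht0 (hgood (hscale x hx)).1.2
  obtain ⟨v, hv⟩ := exists_eval_eq (g := fun x => t * ρ (t * x))
    (fun x hx => (hρd x hx).continuousAt.continuousWithinAt)
    (fun x hx => (hρd x (Metric.ball_subset_closedBall hx)).differentiableWithinAt)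
  obtain ⟨v', hv'⟩ := exists_eval_eq (g := fun x => (t * ρ (t * x))⁻¹)
    (fun x hx => ((hρd x hx).inv (hρne x hx)).continuousAt.continuousWithinAt)
    (fun x hx => ((hρd x (Metric.ball_subset_closedBall hx)).inv
      (hρne x (Metric.ball_subset_closedBall hx))).differentiableWithinAt)
  have hvu : IsUnit v := IsUnit.of_mul_eq_one v' <| ext_eval fun x => by
    rw [eval_mul, hv, hv']
    exact mul_inv_cancel₀ (hρne x x.2)
  obtain ⟨G, hG, hGval, hGsec⟩ := exists_analyticAt_unfolding_eq m hvu
  have hF0 : F (0, t) = (X * v) ^ (m + 1) := ext_eval fun x => by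
    rw [hFft.self_of_nhds x, eval_pow, eval_mul, eval_X, hv, mul_comm (x : ℂ) t,
      (hgood (hscale x x.2)).2]
    ring
  let H : Z → (Fin m → ℂ) × discAlgebra := fun z => G (F (z, t))
  have hFz : AnalyticAt ℂ (fun z : Z => F (z, t)) 0 :=
    AnalyticAt.comp (g := F) (f := fun z : Z => (z, t)) hFt (analyticAt_id.prod analyticAt_const)
  have hH : AnalyticAt ℂ H 0 := AnalyticAt.comp (g := G) (f := fun z : Z => F (z, t))
    (by rw [hF0]; exact hG) hFz
  have hH0 : H 0 = (0, X * v) := by simp only [H, hF0, hGval]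
  have hH2 : AnalyticAt ℂ (fun z => (H z).2) 0 := AnalyticAt.comp (g := Prod.snd) analyticAt_snd hH
  have hdiv : Tendsto (fun w : ℂ => w / t) (𝓝 0) (𝓝 0) := by
    simpa using (continuous_id.div_const t).tendsto (0 : ℂ)
  have hball : ∀ᶠ w in 𝓝 (0 : ℂ), w ∈ Metric.closedBall (0 : ℂ) 1 :=
    Metric.closedBall_mem_nhds 0 one_pos
  refine ⟨fun p => E ((H p.1).2, p.2 / t), fun i z => (H z).1 i, ?_, ?_, fun i => ⟨?_, ?_⟩, ?_⟩
  · refine AnalyticAt.comp (g := E) (f := fun p : Z × ℂ => ((H p.1).2, p.2 / t)) ?_ ?_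
    · simpa using hE (H 0).2
    · refine AnalyticAt.prod ?_ (analyticAt_snd.div analyticAt_const ht0)
      exact AnalyticAt.comp (g := fun z => (H z).2) (f := Prod.fst) hH2 analyticAt_fst
  · filter_upwards [hdiv.eventually hEe, hdiv.eventually hball] with w hw hw1
    simp only [hH0]
    rw [← hw hw1, eval_mul, eval_X, hv]
    simp only
    rw [mul_div_cancel₀ w ht0]
    field_simp
  · exact ((ContinuousLinearMap.proj (R := ℂ) (φ := fun _ : Fin m => ℂ) i).analyticAt _).comp
      (AnalyticAt.comp (g := Prod.fst) analyticAt_fst hH)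
  · simp only [hH0]; rfl
  · have hz : Tendsto (Prod.fst : Z × ℂ → Z) (𝓝 0) (𝓝 0) := continuous_fst.tendsto 0
    have hw : Tendsto (Prod.snd : Z × ℂ → ℂ) (𝓝 0) (𝓝 0) := continuous_snd.tendsto 0
    have hsec : ∀ᶠ z in 𝓝 (0 : Z), unfolding m (H z) = F (z, t) :=
      hFz.continuousAt.eventually (p := fun a => unfolding m (G a) = a)
        (by simpa only [hF0] using hGsec)
    have hid : ∀ᶠ z in 𝓝 (0 : Z), ∀ x, eval x (F (z, t)) = f (z, x * t) :=
      (Continuous.prodMk_left t).continuousAt.eventually hFft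
    filter_upwards [hz.eventually hsec, hz.eventually hid, hw.eventually (hdiv.eventually hEe),
      hw.eventually (hdiv.eventually hball)] with p hp1 hp2 hp3 hp4
    rw [← hp3 hp4, ← eval_unfolding, hp1, hp2]
    simp only
    rw [div_mul_cancel₀ _ ht0]

/-- An analytic `φ` on `Z × ℂ` with `∂φ/∂w ≠ 0` at the origin gives an analytic change of
coordinates `(z, w) ↦ (z, φ (z, w))`. -/
lemma exists_openPartialHomeomorph_eq_fst_prodMk [CompleteSpace Z] {φ : Z × ℂ → ℂ}
    (hφ : AnalyticAt ℂ φ 0) (hφ0 : φ 0 = 0) (hd : fderiv ℂ φ 0 (0, 1) ≠ 0) :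
    ∃ Φ : OpenPartialHomeomorph (Z × ℂ) (Z × ℂ), IsAnalyticCoordinateChange Φ ∧
      ∀ p, Φ p = (p.1, φ p) := by
  set L := fderiv ℂ φ 0
  let M : Z × ℂ →L[ℂ] Z × ℂ := (ContinuousLinearMap.fst ℂ Z ℂ).prod L
  have hsplit : ∀ p : Z × ℂ, L p = L (p.1, 0) + p.2 * L (0, 1) := fun p => by
    rw [← smul_eq_mul, ← map_smul, ← map_add]
    simp
  have hinj : M.ker = ⊥ := by
    refine LinearMap.ker_eq_bot'.2 fun p hp => ?_
    have h1 : p.1 = 0 := congrArg Prod.fst hp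
    have h2 : L p = 0 := congrArg Prod.snd hp
    rw [hsplit, h1, Prod.mk_zero_zero, map_zero, zero_add] at h2
    exact Prod.ext h1 ((mul_eq_zero.1 h2).resolve_right hd)
  have hsurj : M.range = ⊤ := by
    refine LinearMap.range_eq_top.2 fun q => ⟨(q.1, (q.2 - L (q.1, 0)) / L (0, 1)), ?_⟩
    refine Prod.ext rfl ((hsplit _).trans ?_)
    simp only
    rw [div_mul_cancel₀ _ hd]
    ring
  have hf : AnalyticAt ℂ (fun p : Z × ℂ => (p.1, φ p)) 0 := analyticAt_fst.prod hφ
  obtain ⟨Ψ, hΨ, h0, hsymm⟩ := hf.exists_openPartialHomeomorph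
    (ContinuousLinearEquiv.ofBijective M hinj hsurj)
    (by
      rw [ContinuousLinearEquiv.coe_ofBijective]
      exact hasFDerivAt_fst.prodMk hφ.differentiableAt.hasFDerivAt)
  have hf0 : ((0 : Z × ℂ).1, φ 0) = 0 := by rw [hφ0]; rfl
  have hΨ0 : Ψ 0 = 0 := by rw [hΨ]; exact hf0
  rw [hf0] at hsymm
  -- shrink the source so that both the map and its inverse are analytic throughout
  have hnear : ∀ᶠ p in 𝓝 (0 : Z × ℂ), AnalyticAt ℂ Ψ p ∧ AnalyticAt ℂ Ψ.symm (Ψ p) := by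
    refine (hΨ ▸ hf.eventually_analyticAt).and ?_
    have hc : Tendsto Ψ (𝓝 0) (𝓝 0) := by
      simpa only [hΨ0] using (Ψ.continuousAt h0).tendsto
    exact hc.eventually hsymm.eventually_analyticAt
  obtain ⟨U, hU, hUo, h0U⟩ := eventually_nhds_iff.1 hnear
  refine ⟨Ψ.restrOpen U hUo, ⟨⟨h0, h0U⟩, hΨ0, fun p hp => (hU p hp.2).1, fun q hq => ?_⟩,
    fun p => congrFun hΨ p⟩
  have h1 : q ∈ Ψ.target ∧ Ψ.symm q ∈ U := by
    simpa using hq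
  have h2 := (hU _ h1.2).2
  rw [Ψ.right_inv h1.1] at h2
  exact h2

end Reduction

/-- A nonvanishing analytic germ has an analytic `k`-th root. -/
lemma AnalyticAt.exists_pow_eq {g : ℂ → ℂ} {a : ℂ} (hg : AnalyticAt ℂ g a) (ha : g a ≠ 0) {k : ℕ}
    (hk : k ≠ 0) : ∃ ρ : ℂ → ℂ, AnalyticAt ℂ ρ a ∧ ρ a ≠ 0 ∧ ∀ w, ρ w ^ k = g w := by
  -- normalise so that the value at `a` is `1`, where the principal root is analytic
  obtain ⟨b, hb⟩ := IsAlgClosed.exists_pow_nat_eq (g a) (Nat.pos_of_ne_zero hk)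
  have hb0 : b ≠ 0 := fun h => ha (by rw [← hb, h, zero_pow hk])
  refine ⟨fun w => b * (g w / g a) ^ ((k : ℂ)⁻¹), ?_, ?_, fun w => ?_⟩
  · refine analyticAt_const.mul ((hg.div analyticAt_const ha).cpow analyticAt_const ?_)
    simp [div_self ha]
  · simpa [div_self ha] using hb0
  · simp only
    rw [mul_pow, Complex.cpow_nat_inv_pow _ hk, hb, mul_div_cancel₀ _ ha]

theorem theorem2 (n k : ℕ) (hk : 1 ≤ k) (f : (Fin n → ℂ) × ℂ → ℂ)
    (hf : AnalyticAt ℂ f 0)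
    (hord : analyticOrderAt (fun w : ℂ => f (0, w)) 0 = (k : ℕ∞)) :
    ∃ Φ : OpenPartialHomeomorph ((Fin n → ℂ) × ℂ) ((Fin n → ℂ) × ℂ),
      IsAnalyticChangeOfLastCoordinate Φ ∧
      ∃ c : Fin k → (Fin n → ℂ) → ℂ,
        (∀ i, AnalyticAt ℂ (c i) 0 ∧ c i 0 = 0) ∧
        ∀ᶠ p : (Fin n → ℂ) × ℂ in 𝓝 0,
          f (Φ.symm p) = p.2 ^ k + ∑ i : Fin k, c i p.1 * p.2 ^ (i : ℕ) := by
  -- the coefficient of `w ^ m` is not needed, and is taken to be zero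
  obtain ⟨m, rfl⟩ : ∃ m, k = m + 1 := ⟨k - 1, by omega⟩
  have hfw : AnalyticAt ℂ (fun w : ℂ => f (0, w)) 0 :=
    AnalyticAt.comp (g := f) (f := fun w : ℂ => ((0 : Fin n → ℂ), w)) hf
      (analyticAt_const.prod analyticAt_id)
  obtain ⟨g, hg, hg0, hfg⟩ := hfw.analyticOrderAt_eq_natCast.1 hord
  obtain ⟨ρ, hρ, hρ0, hρg⟩ := hg.exists_pow_eq hg0 m.succ_ne_zero
  obtain ⟨φ, c, hφ, hφρ, hc, hfφ⟩ := exists_analyticAt_eq_pow_add_sum hf hρ hρ0 (m := m) <| by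
    filter_upwards [hfg] with w hw
    rw [hw, mul_pow, hρg, sub_zero, smul_eq_mul]
  have hφ0 : φ 0 = 0 := hφρ.self_of_nhds.trans (zero_mul _)
  have hd : fderiv ℂ φ 0 (0, 1) = ρ 0 := by
    have h1 : HasDerivAt (fun w : ℂ => φ (0, w)) (fderiv ℂ φ 0 (0, 1)) 0 :=
      HasFDerivAt.comp_hasDerivAt (l := φ) (f := fun w : ℂ => ((0 : Fin n → ℂ), w)) 0
        hφ.differentiableAt.hasFDerivAt ((hasDerivAt_const _ _).prodMk (hasDerivAt_id _))
    have h2 : HasDerivAt (fun w : ℂ => w * ρ w) (ρ 0) 0 := by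
      refine ((hasDerivAt_id' (0 : ℂ)).mul hρ.differentiableAt.hasDerivAt).congr_deriv ?_
      rw [one_mul, zero_mul, add_zero]
    exact h1.unique (h2.congr_of_eventuallyEq hφρ)
  obtain ⟨Φ, hΦ, hΦφ⟩ := exists_openPartialHomeomorph_eq_fst_prodMk hφ hφ0 (hd ▸ hρ0)
  refine ⟨Φ, ⟨hΦ, fun p _ => by rw [hΦφ]⟩, Fin.snoc c 0, fun i => ?_, ?_⟩
  · refine Fin.lastCases ?_ (fun j => ?_) i
    · rw [Fin.snoc_last]
      exact ⟨analyticAt_const, rfl⟩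
    · rw [Fin.snoc_castSucc]
      exact hc j
  · have h0 : (0 : (Fin n → ℂ) × ℂ) ∈ Φ.target := by
      simpa only [hΦ.map_zero] using Φ.map_source hΦ.zero_mem_source
    have hlim : Tendsto Φ.symm (𝓝 0) (𝓝 0) := by
      have h1 := (Φ.continuousAt_symm h0).tendsto
      have h2 := Φ.left_inv hΦ.zero_mem_source
      rw [hΦ.map_zero] at h2
      rwa [h2] at h1
    filter_upwards [hlim.eventually hfφ, Φ.open_target.mem_nhds h0] with p hp hpt
    have h1 : ((Φ.symm p).1, φ (Φ.symm p)) = p := (hΦφ _).symm.trans (Φ.right_inv hpt)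
    have h2 : (Φ.symm p).1 = p.1 := (Prod.ext_iff.1 h1).1
    have h3 : φ (Φ.symm p) = p.2 := (Prod.ext_iff.1 h1).2
    rw [hp, h2, h3, Fin.sum_univ_castSucc]
    simp
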